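/- Let $N\in\mathbb N$, let $\mathcal E_1,\dots,\mathcal E_N\in\mathbb R$ with $\sum_i\mathcal E_i=0$, let $\tilde H_0=\mathrm{diag}(\mathcal E_1,\dots,\mathcal E_N)$, let $\tilde H_1$ be a traceless Hermitian $N\times N$ matrix, and put $A=-i\tilde H_0$, $B=(b_{jk})=-i\tilde H_1\in\mathfrak{su}(N)$. Consider the control system $$\dot X(t)=(A+u(t)B)\,X(t),\qquad X(t)\in SU(N),\qquad X(0)=I,$$ with piecewise constant inputs $u$ with values in $\mathbb R$. The system is called controllable if every $\bar X\in SU(N)$ equals $X(t)$ for some $t\ge 0$ and some input $u$. For a matrix $M=(m_{jk})$ that is Hermitian or skew-Hermitian, $\mathcal G_M$ is the graph on $\{1,\dots,N\}$ in which $j\ne k$ are joined if and only if $m_{jk}\ne0$. Let $\Delta=\{(j,k): j\neq k\}$ be the set of roots, where $\alpha=(j,k)$ takes the value $\alpha(H)=h_j-h_k$ at a diagonal matrix $H=\mathrm{diag}(h_1,\dots,h_N)$, and let $\Gamma=\{(j,k)\in\Delta : b_{jk}\ne 0\}$. Call a root $\alpha$ regular for $H$ if $\alpha(H)\ne\beta(H)$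 for every root $\beta\in\Delta$ with $\beta\neq\alpha$. Let $B_0$ be the diagonal part of $B$ and $C=[A,B]$. Let $B_r$ be the sum of $B_0$ and the matrix whose $(j,k)$ entry is $b_{jk}$ if $(j,k)\in\Gamma$ is regular for $A$ and $0$ otherwise; let $C_r$ be the matrix whose $(j,k)$ entry is that of $C$ if $(j,k)\in\Gamma$ is regular for $B_0$ and $0$ otherwise. Assume $\mathcal E_i\ne\mathcal E_j$ for $i\neq j$ and that $\mathcal G_B$ is connected. If $\mathcal G_{B_r}\cup\mathcal G_{C_r}$ is connected, then the system is controllable. The same holds if, in the definitions of $B_r$ and $C_r$, the regularity of a root $\alpha\in\Gamma$ is tested only against the other roots $\beta\in\Gamma$ instead of all $\beta\in\Delta$. -/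

import Mathlib

open scoped Matrix Topology

noncomputable section

namespace QuantumControl

/-! ## The control system on `SU(N)` -/

/-- Admissible inputs on `[0, t]`: piecewise constant functions with finitely many switching
times. The values are arbitrary real numbers. -/
def IsAdmissibleInput (t : ℝ) (u : ℝ → ℝ) : Prop :=
  ∃ F : Finset ℝ, ∀ s ∈ Set.Ioo 0 t, s ∉ F → ∀ᶠ s' in 𝓝 s, u s' = u s

/-- `X` is the integral curve on `[0, t]`, in `SU(N)` and starting at the identity, of
`X' = (A + u B) X`. As `u` may jump, `X` is continuous and solves the equation away from a finite
set of times. -/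
def IsIntegralCurve {N : ℕ} (A B : Matrix (Fin N) (Fin N) ℂ) (t : ℝ) (u : ℝ → ℝ)
    (X : ℝ → Matrix (Fin N) (Fin N) ℂ) : Prop :=
  ContinuousOn X (Set.Icc 0 t) ∧ X 0 = 1 ∧
    (∀ s ∈ Set.Icc 0 t, X s ∈ Matrix.specialUnitaryGroup (Fin N) ℂ) ∧
    ∃ F : Finset ℝ, ∀ s ∈ Set.Ioo 0 t, s ∉ F → HasDerivAt X ((A + u s • B) * X s) s

/-- The set of points of `SU(N)` that the system `X' = (A + u B) X`, `X(0) = I`, reaches at some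
time `t ≥ 0` under some admissible input. -/
def reachableSet {N : ℕ} (A B : Matrix (Fin N) (Fin N) ℂ) : Set (Matrix (Fin N) (Fin N) ℂ) :=
  {Y | Y ∈ Matrix.specialUnitaryGroup (Fin N) ℂ ∧
    ∃ t : ℝ, 0 ≤ t ∧ ∃ u : ℝ → ℝ, IsAdmissibleInput t u ∧
      ∃ X : ℝ → Matrix (Fin N) (Fin N) ℂ, IsIntegralCurve A B t u X ∧ X t = Y}

/-- Global controllability: every element of `SU(N)` is reachable from the identity. -/
def IsControllable {N : ℕ} (A B : Matrix (Fin N) (Fin N) ℂ) : Prop :=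
  reachableSet A B = {Y | Y ∈ Matrix.specialUnitaryGroup (Fin N) ℂ}

/-- The drift `A = -i H₀`, where `H₀` is diagonal with the energy levels `E` as entries. -/
def drift {N : ℕ} (E : Fin N → ℝ) : Matrix (Fin N) (Fin N) ℂ :=
  -Complex.I • Matrix.diagonal fun i => (E i : ℂ)

/-- The graph of a (Hermitian or skew-Hermitian) matrix: distinct nodes `i`, `j` are joined if and
only if the `(i, j)` or the `(j, i)` entry is nonzero. Loops do not matter for connectivity. -/
def graph {N : ℕ} (M : Matrix (Fin N) (Fin N) ℂ) : SimpleGraph (Fin N) :=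
  SimpleGraph.fromRel fun i j => M i j ≠ 0

/-! ## Roots. The root `α_{ij}` of `sl(N, ℂ)` is encoded by the pair `(i, j)`, `i ≠ j`. -/

/-- The set `Δ` of all (positive and negative) roots. -/
def roots (N : ℕ) : Set (Fin N × Fin N) := {p | p.1 ≠ p.2}

/-- The roots touched by `B`: the set `Γ = Γ⁺ ∪ -Γ⁺`, for skew-Hermitian `B`. -/
def touchedRoots {N : ℕ} (B : Matrix (Fin N) (Fin N) ℂ) : Set (Fin N × Fin N) :=
  {p | p.1 ≠ p.2 ∧ B p.1 p.2 ≠ 0}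

/-- The value `α_{ij}(H) = h_i - h_j` of a root at a diagonal matrix `H`. -/
def rootValue {N : ℕ} (p : Fin N × Fin N) (H : Matrix (Fin N) (Fin N) ℂ) : ℂ :=
  H p.1 p.1 - H p.2 p.2

/-- The roots in `R` that are regular for the diagonal matrix `H`: their value at `H` differs from
the values of all other roots in `R`. When `R = -R` the condition covers the opposite root, so
that a regular root has a nonzero value, and `p` is regular if and only if `-p` is. -/
def regularRoots {N : ℕ} (R : Set (Fin N × Fin N)) (H : Matrix (Fin N) (Fin N) ℂ) :
    Set (Fin N × Fin N) :=
  {p | p ∈ R ∧ ∀ q ∈ R, q ≠ p → rootValue q H ≠ rootValue p H}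

open Classical in
/-- The part of `M` along a set `S` of roots: the entries with index in `S` are kept, and all the
others are replaced by zero. -/
def partAlong {N : ℕ} (S : Set (Fin N × Fin N)) (M : Matrix (Fin N) (Fin N) ℂ) :
    Matrix (Fin N) (Fin N) ℂ :=
  Matrix.of fun i j => if (i, j) ∈ S then M i j else 0

/-- The diagonal part `B₀` of `B`. -/
def diagPart {N : ℕ} (B : Matrix (Fin N) (Fin N) ℂ) : Matrix (Fin N) (Fin N) ℂ :=
  Matrix.diagonal fun i => B i i

/-- `B_r = B₀ + ∑ (b_α E_α - b_α^* E_{-α})`, the sum over the positive roots touched by `B` that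
are regular for `A` among the roots in `R`. -/
def regularPartB {N : ℕ} (R : Set (Fin N × Fin N)) (A B : Matrix (Fin N) (Fin N) ℂ) :
    Matrix (Fin N) (Fin N) ℂ :=
  diagPart B + partAlong (touchedRoots B ∩ regularRoots R A) B

/-- The level one bracket `C = [A, B] = ∑ α(A) (b_α E_α + b_α^* E_{-α})`. -/
def bracketC {N : ℕ} (A B : Matrix (Fin N) (Fin N) ℂ) : Matrix (Fin N) (Fin N) ℂ :=
  A * B - B * A

/-- `C_r = ∑ α(A) (b_α E_α + b_α^* E_{-α})`, the sum over the positive roots touched by `B` that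
are regular for `B₀` among the roots in `R`. -/
def regularPartC {N : ℕ} (R : Set (Fin N × Fin N)) (A B : Matrix (Fin N) (Fin N) ℂ) :
    Matrix (Fin N) (Fin N) ℂ :=
  partAlong (touchedRoots B ∩ regularRoots R (diagPart B)) (bracketC A B)

end QuantumControl

end

/-!
The reachable set is a subsemigroup `S` of `SU(N)` containing `exp (t (A + u B))` for `t ≥ 0`, and
it is everything as soon as `A` and `B` generate `su(N)`. Indeed, for a maximal space `V` of
velocities of `S` at a point `g ∈ S`, in the left trivialization, precomposing with further
elements of `S` shows that `V` contains the conjugates of `A + u B` by all elements of `S g`. The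
span of the conjugates by `S` is invariant under brackets with `A + u B`, so it contains `su(N)`,
and therefore so does `V`. By the inverse function theorem `S` has an interior point in `SU(N)`.
The group generated by `S` is then open, hence all of the connected group `SU(N)`; compactness
makes `S` dense in it, and a dense subsemigroup with an interior point is everything.

For the generation of `su(N)`, the double bracket with `i diag(d)` multiplies the `(j, k)` entry
by `-(d_j - d_k) ^ 2`, so polynomials in it isolate, in an element of the generated Lie algebra,
the pair of entries at a regular root. This gives the diagonal part `B₀` of `B`, and the root spaces
along the edges of both graphs: those of `B_r` from `A` and `B`, those of `C_r` from `B₀` and `C`.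
Brackets of adjacent root spaces propagate along paths to all the others.
-/

noncomputable section

namespace QuantumControl

open Matrix
open scoped Matrix.Norms.L2Operator

attribute [local instance] LieRing.ofAssociativeRing

section BanachAlgebra

variable {𝔸 : Type*} [NormedRing 𝔸] [NormedAlgebra ℝ 𝔸]

lemma hasDerivAt_mem_of_forall_nonneg {E : Type*} [NormedAddCommGroup E] [NormedSpace ℝ E]
    {W : Submodule ℝ E} (hW : IsClosed (W : Set E)) {f : ℝ → E} {f' : E} (hf : HasDerivAt f f' 0)
    (hfW : ∀ t, 0 ≤ t → f t ∈ W) : f' ∈ W := by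
  have hslope : Filter.Tendsto (slope f 0) (𝓝[>] 0) (𝓝 f') :=
    (hasDerivAt_iff_tendsto_slope.1 hf).mono_left (nhdsWithin_mono _ fun _ hx => ne_of_gt hx)
  refine hW.mem_of_tendsto hslope ?_
  filter_upwards [self_mem_nhdsWithin] with t ht
  rw [slope_def_module]
  exact W.smul_mem _ (W.sub_mem (hfW t (le_of_lt ht)) (hfW 0 le_rfl))

section Conjugates

variable [StarRing 𝔸] {S : Submonoid 𝔸} {𝒳 : Set 𝔸} {X w : 𝔸}

/-- The real span of the conjugates `g⋆ X g` of the elements `X ∈ 𝒳` by the elements `g ∈ S`; for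
`S` inside the unitary group these are the images of `𝒳` under the adjoint action of `S⁻¹`. -/
def conjSpan (S : Submonoid 𝔸) (𝒳 : Set 𝔸) : Submodule ℝ 𝔸 :=
  Submodule.span ℝ {M | ∃ g ∈ S, ∃ X ∈ 𝒳, M = star g * X * g}

lemma subset_conjSpan : 𝒳 ⊆ conjSpan S 𝒳 := fun X hX =>
  Submodule.subset_span ⟨1, one_mem S, X, hX, by simp⟩

lemma star_mul_mul_mem_conjSpan {h : 𝔸} (hh : h ∈ S) (hw : w ∈ conjSpan S 𝒳) :
    star h * w * h ∈ conjSpan S 𝒳 := by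
  induction hw using Submodule.span_induction with
  | mem x hx =>
    obtain ⟨g, hg, X, hX, rfl⟩ := hx
    exact Submodule.subset_span ⟨g * h, mul_mem hg hh, X, hX, by simp only [star_mul, mul_assoc]⟩
  | zero => simp
  | add x y _ _ hx hy => rw [mul_add, add_mul]; exact add_mem hx hy
  | smul r x _ hx => rw [mul_smul_comm, smul_mul_assoc]; exact Submodule.smul_mem _ r hx

lemma star_exp_of_mem_unitary [CompleteSpace 𝔸] (hX : NormedSpace.exp X ∈ unitary 𝔸) :
    star (NormedSpace.exp X) = NormedSpace.exp (-X) := by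
  let +nondep : NormedAlgebra ℚ 𝔸 := .restrictScalars ℚ ℝ 𝔸
  refine left_inv_eq_right_inv (Unitary.star_mul_self_of_mem hX) ?_
  rw [← NormedSpace.exp_add_of_commute (Commute.refl X).neg_right, add_neg_cancel,
    NormedSpace.exp_zero]

variable [FiniteDimensional ℝ 𝔸]

/-- The bracket is minus the one-sided derivative at `0` of `t ↦ exp (-t X) w exp (t X)`. -/
lemma lie_mem_conjSpan (hS : S ≤ unitary 𝔸)
    (hX : ∀ t : ℝ, 0 ≤ t → NormedSpace.exp (t • X) ∈ S) (hw : w ∈ conjSpan S 𝒳) :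
    ⁅X, w⁆ ∈ conjSpan S 𝒳 := by
  have := FiniteDimensional.complete ℝ 𝔸
  have hderiv : HasDerivAt
      (fun t : ℝ => NormedSpace.exp (t • -X) * w * NormedSpace.exp (t • X)) (-⁅X, w⁆) 0 :=
    (((hasDerivAt_exp_smul_const (-X) (0 : ℝ)).mul_const w).mul
      (hasDerivAt_exp_smul_const X (0 : ℝ))).congr_deriv (by
        simp [Ring.lie_def, add_comm, sub_eq_add_neg])
  refine neg_mem_iff.1 (hasDerivAt_mem_of_forall_nonneg
    (conjSpan S 𝒳).closed_of_finiteDimensional hderiv fun t ht => ?_)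
  rw [smul_neg, ← star_exp_of_mem_unitary (hS (hX t ht))]
  exact star_mul_mul_mem_conjSpan (hX t ht) hw

lemma lieSpan_le_conjSpan (hS : S ≤ unitary 𝔸)
    (h𝒳 : ∀ X ∈ 𝒳, ∀ t : ℝ, 0 ≤ t → NormedSpace.exp (t • X) ∈ S) :
    (LieSubalgebra.lieSpan ℝ 𝔸 𝒳).toSubmodule ≤ conjSpan S 𝒳 := by
  intro X hX
  suffices X ∈ conjSpan S 𝒳 ∧ ∀ w ∈ conjSpan S 𝒳, ⁅X, w⁆ ∈ conjSpan S 𝒳 from this.1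
  induction hX using LieSubalgebra.lieSpan_induction with
  | mem X hX => exact ⟨subset_conjSpan hX, fun w => lie_mem_conjSpan hS (h𝒳 X hX)⟩
  | zero => exact ⟨zero_mem _, fun w _ => by simp⟩
  | add X Y _ _ hX hY =>
    exact ⟨add_mem hX.1 hY.1, fun w hw => by rw [add_lie]; exact add_mem (hX.2 w hw) (hY.2 w hw)⟩
  | smul r X _ hX =>
    exact ⟨Submodule.smul_mem _ r hX.1, fun w hw => by
      rw [smul_lie]; exact Submodule.smul_mem _ r (hX.2 w hw)⟩
  | lie X Y _ _ hX hY =>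
    exact ⟨hX.2 Y hY.1, fun w hw => by
      rw [lie_lie]; exact sub_mem (hX.2 _ (hY.2 w hw)) (hY.2 _ (hX.2 w hw))⟩

end Conjugates

section VelocitySpace

variable {S : Submonoid 𝔸} {V : Submodule ℝ 𝔸} {X g w : 𝔸}

/-- `V` consists of velocities of the semigroup `S` at `g`, in the left trivialization: a family
`Ψ` of elements of `S` with `Ψ 0 = g` has derivative `g v` in every direction `v ∈ V`. All families
are parametrized by a neighborhood of `0` in the whole algebra, so that different subspaces `V` can
be compared. -/
def IsVelocitySpace (S : Submonoid 𝔸) (g : 𝔸) (V : Submodule ℝ 𝔸) : Prop :=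
  ∃ (Ψ : 𝔸 → 𝔸) (D : 𝔸 →L[ℝ] 𝔸), HasStrictFDerivAt Ψ D 0 ∧ (∀ᶠ m in 𝓝 0, Ψ m ∈ S) ∧ Ψ 0 = g ∧
    ∀ v ∈ V, D v = g * v

lemma isVelocitySpace_one_bot (S : Submonoid 𝔸) : IsVelocitySpace S 1 ⊥ :=
  ⟨fun _ => 1, 0, hasStrictFDerivAt_const _ _, .of_forall fun _ => one_mem S, rfl, by simp⟩

lemma IsVelocitySpace.mem (hV : IsVelocitySpace S g V) : g ∈ S := by
  obtain ⟨Ψ, _, _, hΨS, rfl, _⟩ := hV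
  exact hΨS.self_of_nhds

lemma IsVelocitySpace.mono {W : Submodule ℝ 𝔸} (hV : IsVelocitySpace S g V) (hWV : W ≤ V) :
    IsVelocitySpace S g W := by
  obtain ⟨Ψ, D, hΨ, hΨS, hg, hD⟩ := hV
  exact ⟨Ψ, D, hΨ, hΨS, hg, fun v hv => hD v (hWV hv)⟩

/-- If `Ψ` has the velocities `V`, then `exp ((1 + s) X) h Ψ` has the additional velocity in the
direction of `s`, which is the conjugate `w` of `X` by `h g`. -/
lemma IsVelocitySpace.sup_span_singleton [FiniteDimensional ℝ 𝔸] (hV : IsVelocitySpace S g V)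
    (hX : ∀ t : ℝ, 0 ≤ t → NormedSpace.exp (t • X) ∈ S) {h : 𝔸} (hh : h ∈ S)
    (hw : h * g * w = X * (h * g)) (hwV : w ∉ V) :
    IsVelocitySpace S (NormedSpace.exp X * (h * g)) (V ⊔ Submodule.span ℝ {w}) := by
  have := FiniteDimensional.complete ℝ 𝔸
  obtain ⟨Ψ, D, hΨ, hΨS, rfl, hD⟩ := hV
  obtain ⟨f₀, hf₀w, hf₀V⟩ := V.exists_le_ker_of_notMem hwV
  let f : 𝔸 →L[ℝ] ℝ := LinearMap.toContinuousLinearMap ((f₀ w)⁻¹ • f₀)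
  have hfw : f w = 1 := by simp [f, hf₀w]
  have hfV : ∀ v ∈ V, f v = 0 := fun v hv => by simp [f, LinearMap.mem_ker.1 (hf₀V hv)]
  let P : 𝔸 →L[ℝ] 𝔸 := .id ℝ 𝔸 - f.smulRight w
  have hexp : HasStrictFDerivAt (fun m => NormedSpace.exp ((1 + f m) • X)) _ (0 : 𝔸) :=
    HasStrictFDerivAt.comp (g := fun s : ℝ => NormedSpace.exp (s • X)) (0 : 𝔸)
      (hasStrictDerivAt_exp_smul_const X (1 + f 0)).hasStrictFDerivAt
      (f.hasStrictFDerivAt.const_add 1)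
  have hΨP : HasStrictFDerivAt (fun m => Ψ (P m)) (D.comp P) (0 : 𝔸) :=
    HasStrictFDerivAt.comp (0 : 𝔸) (by rwa [map_zero]) P.hasStrictFDerivAt
  refine ⟨_, _, hexp.mul' (hΨP.const_mul h), ?_, by simp, fun u hu => ?_⟩
  · have hP0 : Filter.Tendsto P (𝓝 0) (𝓝 0) := by simpa using P.continuous.tendsto 0
    have hf0 : ∀ᶠ m in 𝓝 0, -1 < f m :=
      f.continuous.continuousAt.eventually_const_lt (by simp)
    filter_upwards [hP0.eventually hΨS, hf0] with m hm hfm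
    exact mul_mem (hX _ (by linarith)) (mul_mem hh hm)
  · obtain ⟨v, hv, _, hcw, rfl⟩ := Submodule.mem_sup.1 hu
    obtain ⟨c, rfl⟩ := Submodule.mem_span_singleton.1 hcw
    simp [P, hfw, hfV v hv, hD v hv, mul_add, mul_assoc, ← hw]

lemma exists_isVelocitySpace [StarRing 𝔸] [FiniteDimensional ℝ 𝔸] (hS : S ≤ unitary 𝔸)
    {𝒳 : Set 𝔸} (h𝒳 : ∀ X ∈ 𝒳, ∀ t : ℝ, 0 ≤ t → NormedSpace.exp (t • X) ∈ S)
    {𝔤 : Submodule ℝ 𝔸} (h𝔤S : ∀ g ∈ S, ∀ M ∈ 𝔤, g * M * star g ∈ 𝔤)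
    (h𝔤𝒳 : 𝔤 ≤ (LieSubalgebra.lieSpan ℝ 𝔸 𝒳).toSubmodule) :
    ∃ g, IsVelocitySpace S g 𝔤 := by
  obtain ⟨V, ⟨⟨g, hg⟩, hmax⟩⟩ := exists_maximal_of_wellFoundedGT
    (fun V => ∃ g, IsVelocitySpace S g V) ⟨_, 1, isVelocitySpace_one_bot S⟩
  refine ⟨g, hg.mono ?_⟩
  have hgU := hS hg.mem
  have hconj : ∀ h ∈ S, ∀ X ∈ 𝒳, star (h * g) * X * (h * g) ∈ V := by
    intro h hh X hX
    by_contra hw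
    refine hw (hmax ⟨_, hg.sup_span_singleton (h𝒳 X hX) hh ?_ hw⟩ le_sup_left
      (Submodule.mem_sup_right (Submodule.mem_span_singleton_self _)))
    rw [← mul_assoc (h * g), ← mul_assoc (h * g),
      Unitary.mul_star_self_of_mem (mul_mem (hS hh) hgU), one_mul]
  have hspan : ∀ M ∈ conjSpan S 𝒳, star g * M * g ∈ V := by
    intro M hM
    induction hM using Submodule.span_induction with
    | mem M hM =>
      obtain ⟨h, hh, X, hX, rfl⟩ := hM
      simpa only [star_mul, mul_assoc] using hconj h hh X hX
    | zero => simp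
    | add x y _ _ hx hy => rw [mul_add, add_mul]; exact add_mem hx hy
    | smul r x _ hx => rw [mul_smul_comm, smul_mul_assoc]; exact V.smul_mem r hx
  intro M hM
  have hM' := hspan _ (lieSpan_le_conjSpan hS h𝒳 (h𝔤𝒳 (h𝔤S g hg.mem M hM)))
  rwa [mul_assoc, mul_assoc, mul_assoc, Unitary.star_mul_self_of_mem hgU, mul_one, ← mul_assoc,
    Unitary.star_mul_self_of_mem hgU, one_mul] at hM'

end VelocitySpace

section Exp

lemma exists_injOn_exp (𝔸 : Type*) [NormedRing 𝔸] [NormedAlgebra ℝ 𝔸] [CompleteSpace 𝔸] :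
    ∃ U ∈ 𝓝 (0 : 𝔸), Set.InjOn NormedSpace.exp U := by
  have hexp : HasStrictFDerivAt NormedSpace.exp
      ((ContinuousLinearEquiv.refl ℝ 𝔸 : 𝔸 ≃L[ℝ] 𝔸) : 𝔸 →L[ℝ] 𝔸) 0 := hasStrictFDerivAt_exp_zero
  exact ⟨_, hexp.eventually_left_inverse, fun X hX Y hY hXY => by
    rw [← hX.out, hXY, hY.out]⟩

lemma eventually_star_eq_neg_of_exp_mem_unitary {𝔸 : Type*} [NormedRing 𝔸] [NormedAlgebra ℝ 𝔸]
    [CompleteSpace 𝔸] [StarRing 𝔸] [ContinuousStar 𝔸] :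
    ∀ᶠ X in 𝓝 (0 : 𝔸), NormedSpace.exp X ∈ unitary 𝔸 → star X = -X := by
  let +nondep : NormedAlgebra ℚ 𝔸 := .restrictScalars ℚ ℝ 𝔸
  obtain ⟨U, hU, hinj⟩ := exists_injOn_exp 𝔸
  have hstar : ∀ᶠ X in 𝓝 (0 : 𝔸), star X ∈ U := by
    refine continuous_star.continuousAt.eventually_mem ?_
    rwa [star_zero]
  have hneg : ∀ᶠ X in 𝓝 (0 : 𝔸), -X ∈ U := by
    refine continuous_neg.continuousAt.eventually_mem ?_
    rwa [neg_zero]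
  filter_upwards [hstar, hneg] with X hX hX' hexp
  refine hinj hX hX' ?_
  rw [← NormedSpace.star_exp, star_exp_of_mem_unitary hexp]

end Exp

section Interior

lemma exists_log (𝔸 : Type*) [NormedRing 𝔸] [NormedAlgebra ℝ 𝔸] [CompleteSpace 𝔸] :
    ∃ log : 𝔸 → 𝔸, HasStrictFDerivAt log (ContinuousLinearMap.id ℝ 𝔸) 1 ∧ log 1 = 0 ∧
      ∀ᶠ y in 𝓝 1, NormedSpace.exp (log y) = y := by
  have hexp : HasStrictFDerivAt NormedSpace.exp
      ((ContinuousLinearEquiv.refl ℝ 𝔸 : 𝔸 ≃L[ℝ] 𝔸) : 𝔸 →L[ℝ] 𝔸) 0 := hasStrictFDerivAt_exp_zero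
  have h0 : NormedSpace.exp (0 : 𝔸) = 1 := NormedSpace.exp_zero
  refine ⟨hexp.localInverse, ?_, ?_, ?_⟩
  · simpa [h0] using hexp.to_localInverse
  · rw [← h0]; exact hexp.localInverse_apply_image
  · rw [← h0]; exact hexp.eventually_right_inverse

variable [StarRing 𝔸] [FiniteDimensional ℝ 𝔸] {S G : Submonoid 𝔸} {𝔤 : Submodule ℝ 𝔸} {g : 𝔸}

lemma exists_hasStrictFDerivAt_injOn (hG : G ≤ unitary 𝔸) (hstar : ∀ g ∈ G, star g ∈ G)
    (h𝔤 : ∀ᶠ M in 𝓝 0, NormedSpace.exp M ∈ G → M ∈ 𝔤) (hg : g ∈ G) :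
    ∃ (φ : 𝔸 → 𝔤) (D : 𝔸 →L[ℝ] 𝔤), HasStrictFDerivAt φ D g ∧ (∀ v : 𝔤, D (g * v) = v) ∧
      ∃ U ∈ 𝓝 g, Set.InjOn φ (U ∩ G) := by
  have := FiniteDimensional.complete ℝ 𝔸
  have hinv : star g * g = 1 := Unitary.star_mul_self_of_mem (hG hg)
  obtain ⟨log, hlog, hlog1, hexplog⟩ := exists_log 𝔸
  obtain ⟨p, hp⟩ : 𝔤.ClosedComplemented := .of_finiteDimensional_quotient
    𝔤.closed_of_finiteDimensional
  have hchart : ∀ᶠ Y in 𝓝 g, Y ∈ G → log (star g * Y) ∈ 𝔤 ∧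
      NormedSpace.exp (log (star g * Y)) = star g * Y := by
    have hmul : Filter.Tendsto (fun Y => star g * Y) (𝓝 g) (𝓝 1) := by
      simpa only [hinv] using (continuous_const_mul (star g)).tendsto g
    have hlog0 : Filter.Tendsto log (𝓝 1) (𝓝 0) := by
      simpa only [hlog1] using hlog.continuousAt.tendsto
    filter_upwards [hmul.eventually hexplog, (hlog0.comp hmul).eventually h𝔤] with Y hY hY𝔤 hYG
    exact ⟨hY𝔤 (by simpa only [Function.comp_apply, hY] using mul_mem (hstar _ hg) hYG), hY⟩
  refine ⟨fun Y => p (log (star g * Y)), _, p.hasStrictFDerivAt.comp g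
    (HasStrictFDerivAt.comp g (by rwa [hinv]) ((hasStrictFDerivAt_id g).const_mul (star g))),
    fun v => by simp [← mul_assoc, hinv, hp], _, hchart, ?_⟩
  rintro Y ⟨hY, hYG⟩ Z ⟨hZ, hZG⟩ hYZ
  obtain ⟨hY𝔤, hYexp⟩ := hY hYG
  obtain ⟨hZ𝔤, hZexp⟩ := hZ hZG
  have hloc : log (star g * Y) = log (star g * Z) :=
    congrArg Subtype.val ((hp ⟨_, hY𝔤⟩).symm.trans (hYZ.trans (hp ⟨_, hZ𝔤⟩)))
  have heq : star g * Y = star g * Z := by rw [← hYexp, hloc, hZexp]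
  simpa only [← mul_assoc, Unitary.mul_star_self_of_mem (hG hg), one_mul] using
    congrArg (g * ·) heq

/-- In a chart of `G` around `g`, the family that realizes the velocities is a submersion onto the
Lie algebra `𝔤` of `G`. -/
lemma IsVelocitySpace.eventually_mem (hSG : S ≤ G) (hG : G ≤ unitary 𝔸)
    (hstar : ∀ g ∈ G, star g ∈ G) (h𝔤 : ∀ᶠ M in 𝓝 0, NormedSpace.exp M ∈ G → M ∈ 𝔤)
    (hg : IsVelocitySpace S g 𝔤) : ∀ᶠ Y in 𝓝 g, Y ∈ G → Y ∈ S := by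
  have := FiniteDimensional.complete ℝ 𝔸
  have hgG := hSG hg.mem
  obtain ⟨Ψ, D, hΨ, hΨS, rfl, hD⟩ := hg
  obtain ⟨φ, D', hφ, hD', U, hU, hφU⟩ := exists_hasStrictFDerivAt_injOn hG hstar h𝔤 hgG
  have hmap : Filter.map (φ ∘ Ψ) (𝓝 0) = 𝓝 (φ (Ψ 0)) :=
    (hφ.comp 0 hΨ).map_nhds_eq_of_surj <| LinearMap.range_eq_top.2 fun v => ⟨v, by
      simp [hD v v.2, hD']⟩
  have hsol : ∀ᶠ y in 𝓝 (φ (Ψ 0)), ∃ m, (Ψ m ∈ S ∧ Ψ m ∈ U) ∧ φ (Ψ m) = y := by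
    rw [← hmap, Filter.eventually_map]
    filter_upwards [hΨS, hΨ.continuousAt.eventually hU] with m hm hmU using ⟨m, ⟨hm, hmU⟩, rfl⟩
  filter_upwards [hU, hφ.continuousAt.eventually hsol] with Y hYU ⟨m, ⟨hmS, hmU⟩, hm⟩ hYG
  exact hφU ⟨hmU, hSG hmS⟩ ⟨hYU, hYG⟩ hm ▸ hmS

end Interior

end BanachAlgebra

section SpecialUnitaryGroup

lemma submonoid_eq_top_of_interior_nonempty {G : Type*} [Group G] [TopologicalSpace G]
    [IsTopologicalGroup G] [CompactSpace G] [PreconnectedSpace G] {S : Submonoid G}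
    (hS : (interior (S : Set G)).Nonempty) : S = ⊤ := by
  obtain ⟨g, hg⟩ := hS
  have hopen : IsOpen (Subgroup.closure (S : Set G) : Set G) :=
    (Subgroup.closure (S : Set G)).isOpen_of_mem_nhds
      (Filter.mem_of_superset (mem_interior_iff_mem_nhds.1 hg) Subgroup.subset_closure)
  have huniv : (Subgroup.closure (S : Set G) : Set G) = Set.univ :=
    IsClopen.eq_univ ⟨Subgroup.isClosed_of_isOpen _ hopen, hopen⟩ ⟨1, one_mem _⟩
  have hdense : Dense (S : Set G) := by
    have := dense_submonoidClosure_iff_subgroupClosure.2 (huniv ▸ dense_univ)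
    rwa [S.closure_eq] at this
  refine (Submonoid.eq_top_iff' S).2 fun y => ?_
  obtain ⟨s, hsy, hs⟩ := hdense.inter_open_nonempty {s | s⁻¹ * y ∈ interior (S : Set G)}
    (isOpen_interior.preimage (by fun_prop)) ⟨y * g⁻¹, by simpa using hg⟩
  simpa using mul_mem hs (interior_subset hsy)

variable {n : Type*} [Fintype n] [DecidableEq n]

instance : IsTopologicalGroup (specialUnitaryGroup n ℂ) where
  continuous_inv := continuous_subtype_val.star.subtype_mk _

instance : CompactSpace (specialUnitaryGroup n ℂ) := by
  refine isCompact_iff_compactSpace.1 (Metric.isCompact_of_isClosed_isBounded ?_ ?_)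
  · have hinter : (specialUnitaryGroup n ℂ : Set (Matrix n n ℂ)) =
        (unitary (Matrix n n ℂ) : Set (Matrix n n ℂ)) ∩ det ⁻¹' {1} :=
      Set.ext fun _ => mem_specialUnitaryGroup_iff
    rw [hinter]
    exact isClosed_unitary.inter (isClosed_singleton.preimage continuous_id.matrix_det)
  · refine (Metric.isBounded_closedBall (x := 0) (r := ‖(1 : Matrix n n ℂ)‖)).subset fun M hM => ?_
    rw [mem_closedBall_zero_iff, ← CStarRing.norm_mem_unitary_mul 1
      (specialUnitaryGroup_le_unitaryGroup hM), mul_one]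

/-- As the spectrum of a unitary matrix is finite, the argument is continuous on it. -/
lemma expUnitary_argSelfAdjoint_eq (U : unitaryGroup n ℂ) :
    selfAdjoint.expUnitary (Unitary.argSelfAdjoint U) = U := by
  refine Subtype.ext ?_
  have hcont : ContinuousOn Complex.arg (spectrum ℂ (U : Matrix n n ℂ)) :=
    (Matrix.finite_spectrum (U : Matrix n n ℂ)).continuousOn _
  rw [selfAdjoint.expUnitary_coe, Unitary.argSelfAdjoint_coe,
    ← CFC.exp_eq_normedSpace_exp (𝕜 := ℂ), ← cfc_comp_smul .., ← cfc_comp' ..]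
  conv_rhs => rw [← cfc_id' ℂ (U : Matrix n n ℂ)]
  refine cfc_congr fun z hz => ?_
  have hz_exp := Complex.norm_mul_exp_arg_mul_I z
  rw [spectrum.norm_eq_one_of_unitary U.2 hz, Complex.ofReal_one, one_mul] at hz_exp
  rw [← Complex.exp_eq_exp_ℂ, smul_eq_mul, mul_comm, hz_exp]

instance : PathConnectedSpace (unitaryGroup n ℂ) :=
  pathConnectedSpace_iff_eq.2 ⟨1, Set.eq_univ_of_forall fun U =>
    expUnitary_argSelfAdjoint_eq U ▸ selfAdjoint.joined_one_expUnitary _⟩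

lemma diagonal_mem_unitaryGroup {d : n → ℂ} (hd : ∀ i, d i ∈ unitary ℂ) :
    diagonal d ∈ unitaryGroup n ℂ := by
  rw [mem_unitaryGroup_iff, star_eq_conjTranspose, diagonal_conjTranspose, diagonal_mul_diagonal,
    ← diagonal_one]
  exact congrArg diagonal (funext fun i => Unitary.mul_star_self_of_mem (hd i))

/-- Dividing one row of a unitary matrix by the determinant retracts `U(n)` onto `SU(n)`. -/
instance : PreconnectedSpace (specialUnitaryGroup n ℂ) := by
  rcases isEmpty_or_nonempty n with _ | ⟨⟨o⟩⟩
  · infer_instance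
  let δ : unitaryGroup n ℂ → Matrix n n ℂ := fun U =>
    diagonal (Function.update 1 o (star (U : Matrix n n ℂ).det))
  have hδ (U : unitaryGroup n ℂ) : δ U * U ∈ specialUnitaryGroup n ℂ := by
    refine mem_specialUnitaryGroup_iff.2 ⟨mul_mem (diagonal_mem_unitaryGroup fun i => ?_) U.2, ?_⟩
    · rcases eq_or_ne i o with rfl | hi
      · simpa using Unitary.star_mem (det_of_mem_unitary U.2)
      · simp [hi]
    · rw [det_mul, det_diagonal, Finset.prod_update_of_mem (Finset.mem_univ o)]
      simpa using Unitary.star_mul_self_of_mem (det_of_mem_unitary U.2)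
  have hcont : Continuous fun U => (⟨δ U * U, hδ U⟩ : specialUnitaryGroup n ℂ) := by
    refine Continuous.subtype_mk (Continuous.mul ?_ continuous_subtype_val) _
    exact (continuous_const.update o continuous_subtype_val.matrix_det.star).matrix_diagonal
  refine ⟨?_⟩
  rw [← Set.range_eq_univ.2 fun V => ?_]
  · exact isPreconnected_range hcont
  have hV := mem_specialUnitaryGroup_iff.1 V.2
  exact ⟨⟨V, hV.1⟩, Subtype.ext (by simp [δ, hV.2])⟩

lemma det_exp_smul_of_isHermitian {H : Matrix n n ℂ} (hH : H.IsHermitian) (c : ℂ) :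
    (NormedSpace.exp (c • H)).det = Complex.exp (c * H.trace) := by
  have hconj : c • H = (Unitary.toUnits hH.eigenvectorUnitary : Matrix n n ℂ) *
      diagonal (c • fun i => (hH.eigenvalues i : ℂ)) *
        ((Unitary.toUnits hH.eigenvectorUnitary)⁻¹ : (Matrix n n ℂ)ˣ) := by
    conv_lhs => rw [hH.spectral_theorem, Unitary.conjStarAlgAut_apply]
    simp only [Complex.coe_algebraMap, Unitary.val_toUnits_apply, diagonal_smul,
      Algebra.mul_smul_comm, Unitary.val_inv_toUnits_apply, UnitaryGroup.inv_val,
      Algebra.smul_mul_assoc]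
    rfl
  rw [hconj, Matrix.exp_units_conj, det_units_conj, exp_diagonal, det_diagonal,
    hH.trace_eq_sum_eigenvalues, Finset.mul_sum, Complex.exp_sum]
  simp [Pi.coe_exp, Complex.exp_eq_exp_ℂ]

variable (n) in
/-- The Lie algebra `su(n)` of traceless skew-Hermitian matrices. -/
def su : LieSubalgebra ℝ (Matrix n n ℂ) where
  carrier := {M | Mᴴ = -M ∧ M.trace = 0}
  zero_mem' := by simp
  add_mem' hM hM' := by simp_all [add_comm]
  smul_mem' r M hM := by simp_all
  lie_mem' := by
    rintro M M' ⟨hM, _⟩ ⟨hM', _⟩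
    exact ⟨by simp [Ring.lie_def, hM, hM'], by
      rw [Ring.lie_def, trace_sub, trace_mul_comm, sub_self]⟩

variable {M : Matrix n n ℂ}

lemma mul_mul_star_mem_su {g : Matrix n n ℂ} (hg : g ∈ unitaryGroup n ℂ) (hM : M ∈ su n) :
    g * M * star g ∈ su n := by
  obtain ⟨hskew, htr⟩ := hM
  refine ⟨by simp [star_eq_conjTranspose, hskew, mul_assoc], ?_⟩
  rw [trace_mul_cycle, Unitary.star_mul_self_of_mem hg, one_mul, htr]

lemma det_exp_of_conjTranspose_eq_neg (hM : Mᴴ = -M) :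
    (NormedSpace.exp M).det = Complex.exp M.trace := by
  have hH : (-Complex.I • M).IsHermitian := by simp [IsHermitian, hM]
  simpa [smul_smul, ← mul_assoc] using det_exp_smul_of_isHermitian hH Complex.I

lemma exp_mem_specialUnitaryGroup (hM : M ∈ su n) :
    NormedSpace.exp M ∈ specialUnitaryGroup n ℂ := by
  let +nondep : NormedAlgebra ℚ (Matrix n n ℂ) := .restrictScalars ℚ ℂ _
  refine mem_specialUnitaryGroup_iff.2 ⟨NormedSpace.exp_mem_unitary_of_mem_skewAdjoint hM.1, ?_⟩
  rw [det_exp_of_conjTranspose_eq_neg hM.1, hM.2, Complex.exp_zero]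

lemma eventually_mem_su_of_exp_mem :
    ∀ᶠ M in 𝓝 (0 : Matrix n n ℂ), NormedSpace.exp M ∈ specialUnitaryGroup n ℂ → M ∈ su n := by
  obtain ⟨U, hU, hinj⟩ := exists_injOn_exp ℂ
  have htr : ∀ᶠ M in 𝓝 (0 : Matrix n n ℂ), M.trace ∈ U := by
    refine (continuous_id.matrix_trace).continuousAt.eventually_mem ?_
    rwa [id, trace_zero]
  filter_upwards [eventually_star_eq_neg_of_exp_mem_unitary, htr] with M hskew htr hexp
  obtain ⟨hunit, hdet⟩ := mem_specialUnitaryGroup_iff.1 hexp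
  refine ⟨hskew hunit, hinj htr (mem_of_mem_nhds hU) ?_⟩
  rw [det_exp_of_conjTranspose_eq_neg (hskew hunit)] at hdet
  rw [← Complex.exp_eq_exp_ℂ, hdet, Complex.exp_zero]

theorem eq_specialUnitaryGroup_of_su_le_lieSpan {S : Submonoid (Matrix n n ℂ)}
    (hS : S ≤ specialUnitaryGroup n ℂ) {𝒳 : Set (Matrix n n ℂ)}
    (h𝒳 : ∀ X ∈ 𝒳, ∀ t : ℝ, 0 ≤ t → NormedSpace.exp (t • X) ∈ S)
    (hsu : su n ≤ LieSubalgebra.lieSpan ℝ (Matrix n n ℂ) 𝒳) : S = specialUnitaryGroup n ℂ := by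
  obtain ⟨g, hg⟩ := exists_isVelocitySpace (𝔤 := (su n).toSubmodule)
    (hS.trans specialUnitaryGroup_le_unitaryGroup) h𝒳
    (fun g hg M => mul_mul_star_mem_su (specialUnitaryGroup_le_unitaryGroup (hS hg))) hsu
  have hnhds : ∀ᶠ Y in 𝓝 g, Y ∈ specialUnitaryGroup n ℂ → Y ∈ S :=
    hg.eventually_mem hS specialUnitaryGroup_le_unitaryGroup
      (fun U hU => (star (⟨U, hU⟩ : specialUnitaryGroup n ℂ)).2) eventually_mem_su_of_exp_mem
  have htop : S.comap (specialUnitaryGroup n ℂ).subtype = ⊤ := by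
    refine submonoid_eq_top_of_interior_nonempty
      ⟨⟨g, hS hg.mem⟩, mem_interior_iff_mem_nhds.2 ?_⟩
    filter_upwards [continuousAt_subtype_val.eventually hnhds] with Y hY using hY Y.2
  exact hS.antisymm fun Y hY => (Submonoid.eq_top_iff' _).1 htop ⟨Y, hY⟩

end SpecialUnitaryGroup

section Concatenation

variable {α : Type*} {f g : ℝ → α} {s t t₁ t₂ : ℝ}

/-- The concatenation of `f` on `(-∞, t]` and of `g`, delayed by `t`, on `(t, ∞)`. -/
def concatAt (t : ℝ) (f g : ℝ → α) (s : ℝ) : α :=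
  if s ≤ t then f s else g (s - t)

lemma concatAt_of_le (hs : s ≤ t) : concatAt t f g s = f s := if_pos hs

lemma concatAt_add_of_pos (hs : 0 < s) : concatAt t f g (t + s) = g s := by
  rw [concatAt, if_neg (by linarith), add_sub_cancel_left]

lemma concatAt_of_ge (hfg : g 0 = f t) (hs : t ≤ s) : concatAt t f g s = g (s - t) := by
  rcases hs.eq_or_lt with rfl | hs
  · rw [concatAt_of_le le_rfl, sub_self, hfg]
  · exact if_neg hs.not_ge

lemma concatAt_eventuallyEq_of_lt (hs : s < t) : concatAt t f g =ᶠ[𝓝 s] f := by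
  filter_upwards [Iio_mem_nhds hs] with s' hs' using concatAt_of_le (le_of_lt hs')

lemma concatAt_eventuallyEq_of_pos (hs : 0 < s) :
    concatAt t f g =ᶠ[𝓝 (t + s)] fun s' => g (s' - t) := by
  filter_upwards [Ioi_mem_nhds (lt_add_of_pos_right t hs)] with s' hs' using if_neg hs'.not_ge

lemma continuousOn_concatAt [TopologicalSpace α] (hfg : g 0 = f t₁) (ht₁ : 0 ≤ t₁) (ht₂ : 0 ≤ t₂)
    (hf : ContinuousOn f (Set.Icc 0 t₁)) (hg : ContinuousOn g (Set.Icc 0 t₂)) :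
    ContinuousOn (concatAt t₁ f g) (Set.Icc 0 (t₁ + t₂)) := by
  rw [← Set.Icc_union_Icc_eq_Icc ht₁ (le_add_of_nonneg_right ht₂)]
  refine ContinuousOn.union_of_isClosed (hf.congr fun s hs => concatAt_of_le hs.2) ?_
    isClosed_Icc isClosed_Icc
  refine (hg.comp (continuousOn_id.sub continuousOn_const) fun s hs => ?_).congr
    fun s hs => concatAt_of_ge hfg hs.1
  exact ⟨sub_nonneg.2 hs.1, sub_le_iff_le_add'.2 hs.2⟩

lemma exists_finset_forall_mem_Ioo_add {P : ℝ → Prop}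
    (h₁ : ∃ F : Finset ℝ, ∀ s ∈ Set.Ioo 0 t₁, s ∉ F → P s)
    (h₂ : ∃ F : Finset ℝ, ∀ s ∈ Set.Ioo 0 t₂, s ∉ F → P (t₁ + s)) :
    ∃ F : Finset ℝ, ∀ s ∈ Set.Ioo 0 (t₁ + t₂), s ∉ F → P s := by
  classical
  obtain ⟨F₁, h₁⟩ := h₁
  obtain ⟨F₂, h₂⟩ := h₂
  refine ⟨F₁ ∪ insert t₁ (F₂.image (t₁ + ·)), fun s hs hsF => ?_⟩
  simp only [Finset.mem_union, Finset.mem_insert, Finset.mem_image, not_or, not_exists,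
    not_and] at hsF
  obtain ⟨hsF₁, hst₁, hsF₂⟩ := hsF
  rcases lt_or_gt_of_ne hst₁ with hlt | hgt
  · exact h₁ s ⟨hs.1, hlt⟩ hsF₁
  · have hP := h₂ (s - t₁) ⟨sub_pos.2 hgt, sub_lt_iff_lt_add'.2 hs.2⟩
      fun hF => hsF₂ _ hF (add_sub_cancel t₁ s)
    rwa [add_sub_cancel] at hP

end Concatenation

section Reachability

variable {N : ℕ} {A B X Y : Matrix (Fin N) (Fin N) ℂ} {t t₁ t₂ : ℝ}

lemma IsAdmissibleInput.concatAt {u₁ u₂ : ℝ → ℝ} (hu₁ : IsAdmissibleInput t₁ u₁)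
    (hu₂ : IsAdmissibleInput t₂ u₂) : IsAdmissibleInput (t₁ + t₂) (concatAt t₁ u₁ u₂) := by
  refine exists_finset_forall_mem_Ioo_add ?_ ?_
  · refine hu₁.imp fun F hF s hs hsF => ?_
    rw [concatAt_of_le hs.2.le]
    filter_upwards [hF s hs hsF, concatAt_eventuallyEq_of_lt hs.2] with s' hs' heq
    rw [heq, hs']
  · refine hu₂.imp fun F hF s hs hsF => ?_
    have hshift : Filter.Tendsto (fun s' => s' - t₁) (𝓝 (t₁ + s)) (𝓝 s) := by
      simpa only [add_sub_cancel_left] using (continuous_sub_right t₁).tendsto (t₁ + s)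
    rw [concatAt_add_of_pos hs.1]
    filter_upwards [hshift.eventually (hF s hs hsF), concatAt_eventuallyEq_of_pos hs.1]
      with s' hs' heq
    rw [heq, hs']

lemma IsIntegralCurve.concatAt {u₁ u₂ : ℝ → ℝ} {X₁ X₂ : ℝ → Matrix (Fin N) (Fin N) ℂ}
    (ht₁ : 0 ≤ t₁) (ht₂ : 0 ≤ t₂) (hX₁ : IsIntegralCurve A B t₁ u₁ X₁)
    (hX₂ : IsIntegralCurve A B t₂ u₂ X₂) :
    IsIntegralCurve A B (t₁ + t₂) (concatAt t₁ u₁ u₂)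
      (concatAt t₁ X₁ fun s => X₂ s * X₁ t₁) := by
  obtain ⟨hcont₁, hzero₁, hmem₁, hderiv₁⟩ := hX₁
  obtain ⟨hcont₂, hzero₂, hmem₂, hderiv₂⟩ := hX₂
  have hglue : X₂ 0 * X₁ t₁ = X₁ t₁ := by rw [hzero₂, one_mul]
  refine ⟨continuousOn_concatAt hglue ht₁ ht₂ hcont₁ (hcont₂.mul continuousOn_const),
    by rw [concatAt_of_le ht₁, hzero₁], fun s hs => ?_, exists_finset_forall_mem_Ioo_add ?_ ?_⟩
  · rcases le_total s t₁ with hst | hst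
    · rw [concatAt_of_le hst]
      exact hmem₁ s ⟨hs.1, hst⟩
    · rw [concatAt_of_ge (g := fun s => X₂ s * X₁ t₁) hglue hst]
      exact mul_mem (hmem₂ _ ⟨sub_nonneg.2 hst, sub_le_iff_le_add'.2 hs.2⟩)
        (hmem₁ t₁ ⟨ht₁, le_rfl⟩)
  · refine hderiv₁.imp fun F hF s hs hsF => ?_
    rw [concatAt_of_le hs.2.le, concatAt_of_le hs.2.le]
    exact (hF s hs hsF).congr_of_eventuallyEq (concatAt_eventuallyEq_of_lt hs.2)
  · refine hderiv₂.imp fun F hF s hs hsF => ?_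
    rw [concatAt_add_of_pos hs.1, concatAt_add_of_pos hs.1, ← mul_assoc]
    refine HasDerivAt.congr_of_eventuallyEq ?_ (concatAt_eventuallyEq_of_pos hs.1)
    refine HasDerivAt.mul_const (HasDerivAt.comp_sub_const (t₁ + s) t₁ ?_) (X₁ t₁)
    rw [add_sub_cancel_left]
    exact hF s hs hsF

lemma mul_mem_reachableSet (hX : X ∈ reachableSet A B) (hY : Y ∈ reachableSet A B) :
    X * Y ∈ reachableSet A B := by
  obtain ⟨hYmem, t₁, ht₁, u₁, hu₁, X₁, hX₁, rfl⟩ := hY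
  obtain ⟨hXmem, t₂, ht₂, u₂, hu₂, X₂, hX₂, rfl⟩ := hX
  refine ⟨mul_mem hXmem hYmem, t₁ + t₂, add_nonneg ht₁ ht₂, _, hu₁.concatAt hu₂, _,
    hX₁.concatAt ht₁ ht₂ hX₂, ?_⟩
  rw [concatAt_of_ge (by rw [hX₂.2.1, one_mul]) (le_add_of_nonneg_right ht₂), add_sub_cancel_left]

lemma exp_mem_reachableSet {u : ℝ} (hu : A + u • B ∈ su (Fin N)) (ht : 0 ≤ t) :
    NormedSpace.exp (t • (A + u • B)) ∈ reachableSet A B := by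
  have hmem (s : ℝ) : NormedSpace.exp (s • (A + u • B)) ∈ specialUnitaryGroup (Fin N) ℂ :=
    exp_mem_specialUnitaryGroup ((su (Fin N)).smul_mem s hu)
  have hderiv (s : ℝ) := hasDerivAt_exp_smul_const' (A + u • B) s
  exact ⟨hmem t, t, ht, fun _ => u, ⟨∅, fun _ _ _ => .of_forall fun _ => rfl⟩, _,
    ⟨fun s _ => (hderiv s).continuousAt.continuousWithinAt, by rw [zero_smul, NormedSpace.exp_zero],
      fun s _ => hmem s, ∅, fun s _ _ => hderiv s⟩, rfl⟩

lemma one_mem_reachableSet : 1 ∈ reachableSet A B :=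
  ⟨one_mem _, 0, le_rfl, 0, ⟨∅, by simp⟩, 1,
    ⟨continuousOn_const, rfl, fun _ _ => one_mem _, ∅, by simp⟩, rfl⟩

/-- The reachable set as a semigroup: the control system is right invariant, so that trajectories
can be concatenated. -/
def reachableSubmonoid (A B : Matrix (Fin N) (Fin N) ℂ) :
    Submonoid (Matrix (Fin N) (Fin N) ℂ) where
  carrier := reachableSet A B
  mul_mem' := mul_mem_reachableSet
  one_mem' := one_mem_reachableSet

theorem isControllable_of_su_le_lieSpan (hA : A ∈ su (Fin N)) (hB : B ∈ su (Fin N))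
    (hsu : su (Fin N) ≤ LieSubalgebra.lieSpan ℝ (Matrix (Fin N) (Fin N) ℂ) {A, B}) :
    IsControllable A B := by
  let 𝒳 : Set (Matrix (Fin N) (Fin N) ℂ) := Set.range fun u : ℝ => A + u • B
  have hA𝒳 : A ∈ LieSubalgebra.lieSpan ℝ _ 𝒳 :=
    LieSubalgebra.subset_lieSpan ⟨0, by simp only [zero_smul, add_zero]⟩
  have hB𝒳 : B ∈ LieSubalgebra.lieSpan ℝ _ 𝒳 := by
    have hAB : A + B ∈ LieSubalgebra.lieSpan ℝ _ 𝒳 :=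
      LieSubalgebra.subset_lieSpan ⟨1, by simp only [one_smul]⟩
    simpa only [add_sub_cancel_left] using sub_mem hAB hA𝒳
  have heq : reachableSubmonoid A B = specialUnitaryGroup (Fin N) ℂ := by
    refine eq_specialUnitaryGroup_of_su_le_lieSpan (𝒳 := 𝒳) (fun Y hY => hY.1) ?_
      (hsu.trans (LieSubalgebra.lieSpan_le.2 ?_))
    · rintro _ ⟨u, rfl⟩ t ht
      exact exp_mem_reachableSet (add_mem hA ((su (Fin N)).smul_mem u hB)) ht
    · exact Set.insert_subset hA𝒳 (Set.singleton_subset_iff.2 hB𝒳)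
  exact congrArg SetLike.coe heq

end Reachability

section RootSpaces

variable {n : Type*} {M : Matrix n n ℂ} {a b c : n}

lemma apply_swap_of_conjTranspose_eq_neg (hM : Mᴴ = -M) (i j : n) : M j i = -star (M i j) := by
  rw [← conjTranspose_apply, hM, Matrix.neg_apply, neg_neg]

variable [DecidableEq n]

/-- The skew-Hermitian matrix `z E_ab - z̄ E_ba` in the root space of `±(a, b)`, for `a ≠ b`. For
`a = b` it is the diagonal matrix `(z - z̄) E_aa`. -/
def rootMatrix (a b : n) : ℂ →ₗ[ℝ] Matrix n n ℂ :=
  singleLinearMap ℝ a b - singleLinearMap ℝ b a ∘ₗ Complex.conjAe.toLinearMap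

lemma rootMatrix_apply (a b : n) (z : ℂ) :
    rootMatrix a b z = single a b z - single b a (star z) := rfl

lemma rootMatrix_swap (a b : n) (z : ℂ) : rootMatrix a b z = rootMatrix b a (-star z) := by
  simp [rootMatrix_apply, single_neg, sub_eq_add_neg, add_comm]

variable [Fintype n]

lemma lie_rootMatrix (hab : a ≠ b) (hbc : b ≠ c) (hac : a ≠ c) (z w : ℂ) :
    ⁅rootMatrix a b z, rootMatrix b c w⁆ = rootMatrix a c (z * w) := by
  simp [Ring.lie_def, rootMatrix_apply, mul_sub, sub_mul, hab, hbc, hac, hab.symm, hbc.symm,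
    hac.symm, mul_comm]

lemma lie_rootMatrix_same (hab : a ≠ b) (z w : ℂ) :
    ⁅rootMatrix a b z, rootMatrix a b w⁆ =
      rootMatrix a a (star z * w) - rootMatrix b b (star z * w) := by
  simp only [Ring.lie_def, rootMatrix_apply, mul_sub, sub_mul, ne_eq, hab, hab.symm,
    not_false_eq_true, single_mul_single_of_ne, single_mul_single_same, sub_zero, zero_sub,
    star_mul', star_star, mul_comm]
  abel

lemma sum_rootMatrix (M : Matrix n n ℂ) : ∑ i, ∑ j, rootMatrix i j (M i j) = M - Mᴴ := by
  simp only [rootMatrix_apply, Finset.sum_sub_distrib]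
  rw [← matrix_eq_sum_single, Finset.sum_comm]
  exact congrArg (M - ·) (matrix_eq_sum_single Mᴴ).symm

/-- The graph of the roots `±(a, b)` whose root spaces lie in `L`. -/
def rootGraph (L : LieSubalgebra ℝ (Matrix n n ℂ)) : SimpleGraph n where
  Adj a b := a ≠ b ∧ ∀ z, rootMatrix a b z ∈ L
  symm := ⟨fun a b hab => ⟨hab.1.symm, fun z => rootMatrix_swap b a z ▸ hab.2 _⟩⟩
  loopless := ⟨fun _ h => h.1 rfl⟩

variable {L : LieSubalgebra ℝ (Matrix n n ℂ)}

lemma rootGraph_adj_trans (hab : (rootGraph L).Adj a b) (hbc : (rootGraph L).Adj b c)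
    (hac : a ≠ c) : (rootGraph L).Adj a c := by
  refine ⟨hac, fun z => ?_⟩
  rw [← mul_one z, ← lie_rootMatrix hab.1 hbc.1 hac]
  exact L.lie_mem (hab.2 z) (hbc.2 1)

lemma rootGraph_adj_of_walk (w : (rootGraph L).Walk a b) (hab : a ≠ b) : (rootGraph L).Adj a b := by
  induction w with
  | nil => exact absurd rfl hab
  | @cons a c b hac w ih =>
    rcases eq_or_ne c b with rfl | hcb
    · exact hac
    · exact rootGraph_adj_trans hac (ih hcb) hab

theorem su_le_of_connected_rootGraph (hL : (rootGraph L).Connected) : su n ≤ L := by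
  have hroot (i j : n) (hij : i ≠ j) (z : ℂ) : rootMatrix i j z ∈ L :=
    (rootGraph_adj_of_walk (hL.preconnected i j).some hij).2 z
  obtain ⟨o⟩ := hL.nonempty
  have hdiag (i : n) (z : ℂ) : rootMatrix i i z - rootMatrix o o z ∈ L := by
    rcases eq_or_ne i o with rfl | hio
    · rw [sub_self]
      exact zero_mem L
    · simpa [lie_rootMatrix_same hio] using L.lie_mem (hroot i o hio 1) (hroot i o hio z)
  rintro M ⟨hskew, htr⟩
  have hM : ∑ i, ((∑ j, rootMatrix i j (M i j)) - rootMatrix o o (M i i)) = (2 : ℝ) • M := by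
    have hoo : ∑ i, rootMatrix o o (M i i) = 0 := by
      rw [← map_sum, ← map_zero (rootMatrix o o), ← htr]
      rfl
    rw [Finset.sum_sub_distrib, sum_rootMatrix, hskew, hoo, sub_zero, sub_neg_eq_add, two_smul]
  suffices (2 : ℝ) • M ∈ L.toSubmodule from (Submodule.smul_mem_iff _ two_ne_zero).1 this
  rw [← hM]
  refine sum_mem fun i _ => ?_
  rw [← Finset.add_sum_erase _ _ (Finset.mem_univ i), add_sub_right_comm]
  exact add_mem (hdiag i _) (sum_mem fun j hj => hroot i j (Finset.ne_of_mem_erase hj).symm _)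

end RootSpaces

section Scaling

variable {n : Type*} {d : n → ℝ} {M : Matrix n n ℂ}

/-- The matrix whose `(i, j)` entry is that of `M`, scaled by `f` of the square of the root value
`d i - d j`. Squares make the scaling the same at opposite roots, which keeps skew-Hermitian
matrices skew-Hermitian. -/
def scaleEntries (d : n → ℝ) (f : ℝ → ℝ) (M : Matrix n n ℂ) : Matrix n n ℂ :=
  of fun i j => f ((d i - d j) ^ 2) • M i j

lemma scaleEntries_apply (d : n → ℝ) (f : ℝ → ℝ) (M : Matrix n n ℂ) (i j : n) :
    scaleEntries d f M i j = f ((d i - d j) ^ 2) • M i j := rfl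

variable [DecidableEq n]

lemma scaleEntries_eq_rootMatrix (hM : Mᴴ = -M) {a b : n} (hab : d a ≠ d b)
    (hreg : ∀ i j, i ≠ j → M i j ≠ 0 → (i, j) ≠ (a, b) → d i - d j ≠ d a - d b) :
    scaleEntries d (Set.indicator {(d a - d b) ^ 2} 1) M = rootMatrix a b (M a b) := by
  have hab' : a ≠ b := ne_of_apply_ne d hab
  ext i j
  rw [scaleEntries_apply, rootMatrix_apply, Matrix.sub_apply, single_apply, single_apply]
  by_cases hij : a = i ∧ b = j
  · obtain ⟨rfl, rfl⟩ := hij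
    simp [hab', hab'.symm]
  by_cases hji : b = i ∧ a = j
  · obtain ⟨rfl, rfl⟩ := hji
    simp [hab', sub_sq_comm (d b) (d a), apply_swap_of_conjTranspose_eq_neg hM a b]
  rw [if_neg hij, if_neg hji, sub_zero]
  by_cases hMij : M i j = 0
  · rw [hMij, smul_zero]
  rw [Set.indicator_of_notMem, zero_smul]
  intro hsq
  rcases eq_or_ne i j with rfl | hne
  · simp [sub_eq_zero, hab, eq_comm] at hsq
  rcases sq_eq_sq_iff_eq_or_eq_neg.1 hsq with heq | heq
  · exact hreg i j hne hMij (by grind) heq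
  · refine hreg j i hne.symm ?_ (by grind) (by linarith)
    rwa [apply_swap_of_conjTranspose_eq_neg hM i j, neg_ne_zero, star_ne_zero]

variable [Fintype n] {V : Submodule ℝ (Matrix n n ℂ)}

/-- The skew-Hermitian diagonal matrix `i diag(d)`. -/
def skewDiagonal (d : n → ℝ) : Matrix n n ℂ :=
  diagonal fun i => Complex.I * d i

lemma lie_skewDiagonal_apply (d : n → ℝ) (M : Matrix n n ℂ) (i j : n) :
    ⁅skewDiagonal d, M⁆ i j = (d i - d j : ℝ) * Complex.I * M i j := by
  rw [Ring.lie_def, skewDiagonal, Matrix.sub_apply, diagonal_mul, mul_diagonal]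
  push_cast
  ring

lemma lie_skewDiagonal_single (d : n → ℝ) (a b : n) (z : ℂ) :
    ⁅skewDiagonal d, single a b z⁆ = single a b ((d a - d b : ℝ) * Complex.I * z) := by
  ext i j
  rw [lie_skewDiagonal_apply]
  by_cases hab : a = i ∧ b = j
  · obtain ⟨rfl, rfl⟩ := hab
    rw [single_apply_same, single_apply_same]
  · rw [single_apply_of_ne _ _ _ _ _ hab, single_apply_of_ne _ _ _ _ _ hab, mul_zero]

lemma lie_skewDiagonal_rootMatrix (d : n → ℝ) (a b : n) (z : ℂ) :
    ⁅skewDiagonal d, rootMatrix a b z⁆ = (d a - d b) • rootMatrix a b (Complex.I * z) := by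
  rw [rootMatrix_apply, rootMatrix_apply, lie_sub, lie_skewDiagonal_single,
    lie_skewDiagonal_single, smul_sub, smul_single, smul_single, Complex.real_smul,
    Complex.real_smul, star_mul', RCLike.star_def, Complex.conj_I, ← neg_sub (d a) (d b),
    Complex.ofReal_neg]
  ring_nf

lemma scaleEntries_pow_mem (hV : ∀ M ∈ V, ⁅skewDiagonal d, M⁆ ∈ V) (hM : M ∈ V) (m : ℕ) :
    scaleEntries d (· ^ m) M ∈ V := by
  induction m with
  | zero =>
    convert hM using 1
    ext
    simp [scaleEntries_apply]
  | succ m ih =>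
    convert V.neg_mem (hV _ (hV _ ih)) using 1
    ext i j
    simp only [scaleEntries_apply, Matrix.neg_apply, lie_skewDiagonal_apply, Complex.real_smul]
    push_cast
    linear_combination ((d i - d j : ℂ) ^ 2) ^ (m + 1) * M i j * Complex.I_sq

lemma scaleEntries_eval_mem (hV : ∀ M ∈ V, ⁅skewDiagonal d, M⁆ ∈ V) (hM : M ∈ V)
    (p : Polynomial ℝ) : scaleEntries d p.eval M ∈ V := by
  induction p using Polynomial.induction_on' with
  | add p q hp hq =>
    convert V.add_mem hp hq using 1
    ext
    simp [scaleEntries_apply, add_mul]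
  | monomial m r =>
    convert V.smul_mem r (scaleEntries_pow_mem hV hM m) using 1
    ext
    simp [scaleEntries_apply, mul_assoc]

/-- As there are finitely many root values, `f` may be replaced by an interpolating polynomial. -/
lemma scaleEntries_mem (hV : ∀ M ∈ V, ⁅skewDiagonal d, M⁆ ∈ V) (hM : M ∈ V) (f : ℝ → ℝ) :
    scaleEntries d f M ∈ V := by
  let s : Finset ℝ := Finset.univ.image fun p : n × n => (d p.1 - d p.2) ^ 2
  convert scaleEntries_eval_mem hV hM (Lagrange.interpolate s id f) using 1
  ext i j
  have hij := Lagrange.eval_interpolate_at_node (s := s) (v := id) f Function.injective_id.injOn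
    (Finset.mem_image_of_mem _ (Finset.mem_univ (i, j)))
  rw [scaleEntries_apply, scaleEntries_apply, ← hij, id]

lemma diagonal_diag_mem (hd : Function.Injective d) (hV : ∀ M ∈ V, ⁅skewDiagonal d, M⁆ ∈ V)
    (hM : M ∈ V) : diagonal M.diag ∈ V := by
  classical
  convert scaleEntries_mem hV hM (fun x => if x = 0 then 1 else 0) using 1
  ext i j
  rcases eq_or_ne i j with rfl | hij
  · simp [scaleEntries_apply]
  · simp [scaleEntries_apply, hij, sub_eq_zero, hd.ne hij]

lemma rootMatrix_mem_of_ne {a b : n} (hV : ∀ M ∈ V, ⁅skewDiagonal d, M⁆ ∈ V) (hd : d a ≠ d b)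
    {w : ℂ} (hw : w ≠ 0) (hwV : rootMatrix a b w ∈ V) (z : ℂ) : rootMatrix a b z ∈ V := by
  have hIw : rootMatrix a b (Complex.I * w) ∈ V := by
    rw [← V.smul_mem_iff (sub_ne_zero.2 hd), ← lie_skewDiagonal_rootMatrix]
    exact hV _ hwV
  have hz : z = (z / w).re • w + (z / w).im • (Complex.I * w) := by
    conv_lhs => rw [← div_mul_cancel₀ z hw, ← Complex.re_add_im (z / w)]
    simp only [Complex.real_smul]
    ring
  rw [hz, map_add, map_smul, map_smul]
  exact V.add_mem (V.smul_mem _ hwV) (V.smul_mem _ hIw)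

lemma rootMatrix_mem_of_regular (hV : ∀ M ∈ V, ⁅skewDiagonal d, M⁆ ∈ V) (hM : M ∈ V)
    (hskew : Mᴴ = -M) {a b : n} (hab : a ≠ b) (hMab : M a b ≠ 0)
    (hreg : ∀ i j, i ≠ j → M i j ≠ 0 → (i, j) ≠ (a, b) → d i - d j ≠ d a - d b) (z : ℂ) :
    rootMatrix a b z ∈ V := by
  have hMba : M b a ≠ 0 := by
    rwa [apply_swap_of_conjTranspose_eq_neg hskew a b, neg_ne_zero, star_ne_zero]
  have hd : d a ≠ d b := fun h =>
    hreg b a hab.symm hMba (by simp [hab]) (by rw [h])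
  refine rootMatrix_mem_of_ne hV hd hMab ?_ z
  rw [← scaleEntries_eq_rootMatrix hskew hd hreg]
  exact scaleEntries_mem hV hM _

end Scaling

section GraphCriterion

variable {N : ℕ} {L : LieSubalgebra ℝ (Matrix (Fin N) (Fin N) ℂ)} {E d : Fin N → ℝ}
  {B M : Matrix (Fin N) (Fin N) ℂ} {R S : Set (Fin N × Fin N)}

lemma graph_le_iff {G : SimpleGraph (Fin N)} :
    graph M ≤ G ↔ ∀ i j, i ≠ j → M i j ≠ 0 → G.Adj i j := by
  refine ⟨fun h i j hij hM => h ((SimpleGraph.fromRel_adj _ i j).2 ⟨hij, Or.inl hM⟩),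
    fun h i j hij => ?_⟩
  obtain ⟨hne, hM | hM⟩ := (SimpleGraph.fromRel_adj _ i j).1 hij
  · exact h i j hne hM
  · exact (h j i hne.symm hM).symm

lemma rootValue_skewDiagonal (p : Fin N × Fin N) :
    rootValue p (skewDiagonal d) = Complex.I * (d p.1 - d p.2 : ℝ) := by
  simp [rootValue, skewDiagonal, mul_sub]

lemma graph_partAlong_le_rootGraph (hd : skewDiagonal d ∈ L) (hM : M ∈ L) (hskew : Mᴴ = -M)
    (hR : touchedRoots M ⊆ R) (hS : S ⊆ regularRoots R (skewDiagonal d)) :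
    graph (partAlong S M) ≤ rootGraph L := by
  refine graph_le_iff.2 fun a b hab hne => ⟨hab, fun z => ?_⟩
  obtain ⟨habS, hMab⟩ : (a, b) ∈ S ∧ M a b ≠ 0 := by simpa [partAlong] using hne
  refine rootMatrix_mem_of_regular (V := L.toSubmodule) (fun _ => L.lie_mem hd) hM hskew hab hMab
    (fun i j hij hMij hne heq => (hS habS).2 (i, j) (hR ⟨hij, hMij⟩) hne ?_) z
  rw [rootValue_skewDiagonal, rootValue_skewDiagonal, heq]

lemma drift_eq_skewDiagonal (E : Fin N → ℝ) : drift E = skewDiagonal (-E) := by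
  ext i j
  by_cases hij : i = j <;> simp [drift, skewDiagonal, hij]

lemma diagPart_eq_skewDiagonal (hB : Bᴴ = -B) : diagPart B = skewDiagonal fun i => (B i i).im := by
  refine congrArg diagonal (funext fun i => ?_)
  have hre : (B i i).re = 0 :=
    self_eq_neg.1 (congrArg Complex.re (apply_swap_of_conjTranspose_eq_neg hB i i))
  exact Complex.ext (by simp [hre]) (by simp)

lemma conjTranspose_skewDiagonal (d : Fin N → ℝ) : (skewDiagonal d)ᴴ = -skewDiagonal d := by
  rw [skewDiagonal, diagonal_conjTranspose, diagonal_neg]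
  refine congrArg diagonal (funext fun i => ?_)
  simp

lemma drift_mem_su (hE : ∑ i, E i = 0) : drift E ∈ su (Fin N) := by
  refine ⟨by rw [drift_eq_skewDiagonal, conjTranspose_skewDiagonal], ?_⟩
  rw [drift, trace_smul, trace_diagonal, ← Complex.ofReal_sum, hE, Complex.ofReal_zero, smul_zero]

lemma touchedRoots_bracketC_drift_subset :
    touchedRoots (bracketC (drift E) B) ⊆ touchedRoots B := by
  rintro ⟨i, j⟩ ⟨hij, hne⟩
  refine ⟨hij, fun hB => hne ?_⟩
  rw [drift_eq_skewDiagonal, bracketC, ← Ring.lie_def, lie_skewDiagonal_apply, hB, mul_zero]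

lemma graph_regularPartB_le_rootGraph (hA : drift E ∈ L) (hB : B ∈ L) (hskew : Bᴴ = -B)
    (hR : touchedRoots B ⊆ R) : graph (regularPartB R (drift E) B) ≤ rootGraph L := by
  rw [drift_eq_skewDiagonal] at hA ⊢
  refine le_trans ?_ (graph_partAlong_le_rootGraph hA hB hskew hR
    (Set.inter_subset_right (s := touchedRoots B)))
  exact graph_le_iff.2 fun i j hij hne => graph_le_iff.1 le_rfl i j hij <| by
    simpa [regularPartB, diagPart, hij] using hne

lemma graph_regularPartC_le_rootGraph (hE : Function.Injective E) (hA : drift E ∈ L) (hB : B ∈ L)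
    (hskew : Bᴴ = -B) (hR : touchedRoots B ⊆ R) :
    graph (regularPartC R (drift E) B) ≤ rootGraph L := by
  have hdiag : diagPart B ∈ L.toSubmodule :=
    diagonal_diag_mem (neg_injective.comp hE)
      (fun _ => L.lie_mem (drift_eq_skewDiagonal E ▸ hA)) hB
  have hC : bracketC (drift E) B ∈ L := L.lie_mem hA hB
  have hCskew : (bracketC (drift E) B)ᴴ = -bracketC (drift E) B := by
    simp [bracketC, drift_eq_skewDiagonal, conjTranspose_skewDiagonal, hskew]
  rw [diagPart_eq_skewDiagonal hskew] at hdiag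
  refine graph_partAlong_le_rootGraph hdiag hC hCskew
    (touchedRoots_bracketC_drift_subset.trans hR) ?_
  rw [diagPart_eq_skewDiagonal hskew]
  exact Set.inter_subset_right

theorem su_le_of_connected_regularPart (hE : Function.Injective E) (hA : drift E ∈ L) (hB : B ∈ L)
    (hskew : Bᴴ = -B) (hR : touchedRoots B ⊆ R)
    (hconn : (graph (regularPartB R (drift E) B) ⊔ graph (regularPartC R (drift E) B)).Connected) :
    su (Fin N) ≤ L :=
  su_le_of_connected_rootGraph <| hconn.mono <|
    sup_le (graph_regularPartB_le_rootGraph hA hB hskew hR)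
      (graph_regularPartC_le_rootGraph hE hA hB hskew hR)

theorem isControllable_of_connected_regularPart (hE : Function.Injective E)
    (hA : drift E ∈ su (Fin N)) (hB : B ∈ su (Fin N)) (hR : touchedRoots B ⊆ R)
    (hconn : (graph (regularPartB R (drift E) B) ⊔ graph (regularPartC R (drift E) B)).Connected) :
    IsControllable (drift E) B :=
  isControllable_of_su_le_lieSpan hA hB <| su_le_of_connected_regularPart hE
    (LieSubalgebra.subset_lieSpan (Set.mem_insert _ _))
    (LieSubalgebra.subset_lieSpan (Set.mem_insert_of_mem _ rfl)) hB.1 hR hconn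

end GraphCriterion

end QuantumControl

end

theorem mainTheorem7 {N : ℕ} (E : Fin N → ℝ) (hEtrace : ∑ i, E i = 0)
    (hE : ∀ i j : Fin N, i ≠ j → E i ≠ E j)
    (A B H1 : Matrix (Fin N) (Fin N) ℂ) (hH1 : H1.IsHermitian) (hH1trace : H1.trace = 0)
    (hA : A = QuantumControl.drift E) (hB : B = -Complex.I • H1)
    (hG : (QuantumControl.graph B).Connected) :
    ((QuantumControl.graph (QuantumControl.regularPartB (QuantumControl.roots N) A B) ⊔
        QuantumControl.graph (QuantumControl.regularPartC (QuantumControl.roots N) A B)).Connected →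
      QuantumControl.IsControllable A B) ∧
    ((QuantumControl.graph (QuantumControl.regularPartB (QuantumControl.touchedRoots B) A B) ⊔
        QuantumControl.graph
          (QuantumControl.regularPartC (QuantumControl.touchedRoots B) A B)).Connected →
      QuantumControl.IsControllable A B) := by
  subst hA hB
  have hEinj : Function.Injective E := fun i j hij => by_contra fun hne => hE i j hne hij
  have hA := QuantumControl.drift_mem_su hEtrace
  have hB : -Complex.I • H1 ∈ QuantumControl.su (Fin N) :=
    ⟨by simp [hH1.eq], by rw [Matrix.trace_smul, hH1trace, smul_zero]⟩
  exact ⟨QuantumControl.isControllable_of_connected_regularPart hEinj hA hB fun _ h => h.1,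
    QuantumControl.isControllable_of_connected_regularPart hEinj hA hB subset_rfl⟩
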